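/- **Theorem.** Let $d$ be a positive integer. *Matrices.* A $d$-dimensional 0-1 matrix $A$ contains a $d$-dimensional 0-1 matrix $B$ if some submatrix of $A$ (obtained by selecting indices in each dimension and keeping their order) equals $B$ or can be turned into $B$ by changing some ones to zeroes; otherwise $A$ is $B$-free. For a positive integer $n$, let $\mathrm{ex}(n,M,d)$ be the maximum number of ones in an $M$-free $d$-dimensional 0-1 matrix all of whose dimensions equal $n$ (and $0$ if there is no such matrix). *Point sets.* For $P\subseteq\mathbb{R}^d$ let $C_i(P)$ be the set of $i$-th coordinates of points of $P$. A set $S\subseteq\mathbb{R}^d$ contains $P$ if there are functions $f_i\colon C_i(P)\to C_i(S)$, $i=1,\dots,d$, such that $\frac{f_i(x)-f_i(x')}{x-x'}\ge 1$ for all $i$ and all $x>x'$ in $C_i(P)$, and $(f_1(x_1),\dots,f_d(x_d))\in S$ for all $(x_1,\dots,x_d)\in P$; otherwise $S$ is $P$-free. Let $\mathrm{px}(n,P,d)$ be the supremum of the $d$-dimensional Lebesgue measures of the open $P$-free subsets of $[0,n]^d$ (and $0$ if there is no such subset). For a finite set $P\subseteq\mathbb{R}^d$ let $M_P$ be the $d$-dimensional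 0-1 matrix whose indices in the $i$-th dimension correspond in order to the elements of $C_i(P)$, with a one in each entry corresponding to a point of $P$ and zeroes elsewhere. *Claim.* For every finite $P\subseteq\mathbb{R}^d$ we have $\mathrm{px}(n,P,d)=\Theta(\mathrm{ex}(n,M_P,d))$, with constants that depend only on $d$ and on bounds for the differences between consecutive values of the coordinates of $P$. That is: for all real $0<c_1\le c_2$ there are real constants $A,B>0$, depending only on $d,c_1,c_2$, such that for every finite set $P\subseteq\mathbb{R}^d$ for which, for each $i$, the differences between consecutive elements of $C_i(P)$ all lie in $[c_1,c_2]$ (every finite $P$ has this property for suitable $c_1,c_2$), and for every positive integer $n$, $$A\cdot \mathrm{ex}(n,M_P,d)\ \le\ \mathrm{px}(n,P,d)\ \le\ B\cdot \mathrm{ex}(n,M_P,d).$$ -/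

import Mathlib

open scoped NNReal ENNReal

noncomputable section

/-- A `d`-dimensional 0-1 matrix whose `i`-th dimension has length `k i`
(`true` stands for the entry 1, `false` for the entry 0). -/
abbrev ZeroOneMatrix {d : ℕ} (k : Fin d → ℕ) : Type := (∀ i, Fin (k i)) → Bool

namespace ZeroOneMatrix

variable {d : ℕ} {k l : Fin d → ℕ}

/-- `A` contains `B`: some submatrix of `A`, obtained by selecting `l i` of the indices of every
dimension `i` in increasing order, equals `B` or becomes `B` after changing some ones to zeroes. -/
def Contains (A : ZeroOneMatrix k) (B : ZeroOneMatrix l) : Prop :=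
  ∃ f : ∀ i, Fin (l i) ↪o Fin (k i),
    ∀ b : ∀ i, Fin (l i), B b = true → A (fun i => f i (b i)) = true

/-- The number of ones of `A`. -/
def ones (A : ZeroOneMatrix k) : ℕ := (Finset.univ.filter fun a => A a = true).card

open Classical in
/-- `ex n M`: the maximum number of ones in an `M`-free `d`-dimensional 0-1 matrix all of whose
dimensions equal `n` (and 0 if there is no `M`-free matrix). -/
def ex (n : ℕ) (M : ZeroOneMatrix l) : ℕ :=
  (Finset.univ.filter fun A : ZeroOneMatrix (fun _ : Fin d => n) => ¬ A.Contains M).sup ones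

end ZeroOneMatrix

namespace PointSet

variable {d : ℕ}

/-- The set of all `i`-th coordinates of points of `P`. -/
def coords (P : Set (Fin d → ℝ)) (i : Fin d) : Set ℝ := (fun p => p i) '' P

/-- `S` contains `P`. The values of `f i` outside `coords P i` play no role. -/
def Contains (S P : Set (Fin d → ℝ)) : Prop :=
  ∃ f : Fin d → ℝ → ℝ,
    (∀ i, Set.MapsTo (f i) (coords P i) (coords S i)) ∧
    (∀ i, ∀ x ∈ coords P i, ∀ x' ∈ coords P i, x > x' → (f i x - f i x') / (x - x') ≥ 1) ∧
    ∀ p ∈ P, (fun i => f i (p i)) ∈ S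

/-- `px n P`: the supremum of the Lebesgue measures of the open `P`-free subsets of `[0, n]^d`
(and 0 if there is no such subset). -/
def px (n : ℝ) (P : Set (Fin d → ℝ)) : ℝ≥0∞ :=
  ⨆ S ∈ {S : Set (Fin d → ℝ) |
      IsOpen S ∧ S ⊆ Set.Icc (fun _ => 0) (fun _ => n) ∧ ¬ Contains S P},
    MeasureTheory.volume S

/-- `x` and `y` are consecutive values, with `x < y`, of the `i`-th coordinate of points
of `P`. -/
def Consecutive (P : Set (Fin d → ℝ)) (i : Fin d) (x y : ℝ) : Prop :=
  x ∈ coords P i ∧ y ∈ coords P i ∧ x < y ∧ ∀ z ∈ coords P i, ¬ (x < z ∧ z < y)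

/-- The finite set of values of the `i`-th coordinate of points of the finite set `P`. -/
def coordFinset (P : Finset (Fin d → ℝ)) (i : Fin d) : Finset ℝ := P.image fun p => p i

/-- The 0-1 matrix `M_P`: the indices of its `i`-th dimension enumerate the distinct values of the
`i`-th coordinate of `P` in increasing order, and its ones are the entries given by points
of `P`. -/
def toMatrix (P : Finset (Fin d → ℝ)) : ZeroOneMatrix (fun i => (coordFinset P i).card) :=
  fun b => decide ((fun i => (coordFinset P i).orderEmbOfFin rfl (b i)) ∈ P)

end PointSet

end

open MeasureTheory

namespace ZeroOneMatrix

variable {d : ℕ} {l : Fin d → ℕ}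

/-! Matrices and open sets are converted into each other, at the cost of a factor depending only on
`d`, `c₁`, `c₂`. Lower bound: replace the ones of an extremal matrix by open cubes of side `c = min
c₁ 1`. A copy of `P` moves distinct coordinates at least `c` apart, hence into distinct grid cells
in the same order, and so yields a copy of `M_P` (`contains_of_cubes_contains`). Upper bound: sample
a `P`-free set on a translate of a lattice of spacing `L = max c₂ 2`. A copy of `M_P` among the
samples stretches all gaps of `P` enough to be a copy of `P` (`contains_of_latticeMatrix_contains`),
so every translate meets the set in at most `ex` points; averaging over translates bounds the volume
by `L ^ d * ex`. -/

theorem ones_le_ex {n : ℕ} {M : ZeroOneMatrix l} {A : ZeroOneMatrix (fun _ : Fin d => n)}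
    (h : ¬ A.Contains M) : A.ones ≤ ex n M := by
  classical
  unfold ex
  exact Finset.le_sup (f := ones) (by simpa using h)

/-- `ex n M` is zero or attained by an `M`-free matrix. -/
theorem ex_eq_zero_or_exists (n : ℕ) (M : ZeroOneMatrix l) :
    ex n M = 0 ∨ ∃ A : ZeroOneMatrix (fun _ : Fin d => n), ¬ A.Contains M ∧ A.ones = ex n M := by
  classical
  unfold ex
  rcases Finset.eq_empty_or_nonempty
    (Finset.univ.filter fun A : ZeroOneMatrix (fun _ : Fin d => n) => ¬ A.Contains M) with h | h
  · left
    rw [h]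
    rfl
  · right
    obtain ⟨A, hA, hA'⟩ := Finset.exists_mem_eq_sup _ h ones
    exact ⟨A, by simpa using hA, hA'.symm⟩

/-! ### Cubes of a matrix -/

/-- The union of the open cubes of side length `c` given by the ones of `A`. -/
def cubes {n : ℕ} (c : ℝ) (A : ZeroOneMatrix (fun _ : Fin d => n)) : Set (Fin d → ℝ) :=
  ⋃ a ∈ Finset.univ.filter fun a => A a = true,
    Set.univ.pi fun i => Set.Ioo (c * (a i : ℕ)) (c * ((a i : ℕ) + 1))

theorem mem_cubes {n : ℕ} {c : ℝ} {A : ZeroOneMatrix (fun _ : Fin d => n)} {x : Fin d → ℝ} :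
    x ∈ cubes c A ↔ ∃ a : Fin d → Fin n, A a = true ∧
      ∀ i, x i ∈ Set.Ioo (c * (a i : ℕ)) (c * ((a i : ℕ) + 1)) := by
  simp [cubes]

theorem isOpen_cubes {n : ℕ} (c : ℝ) (A : ZeroOneMatrix (fun _ : Fin d => n)) :
    IsOpen (cubes c A) :=
  isOpen_biUnion fun _ _ => isOpen_set_pi Set.finite_univ fun _ _ => isOpen_Ioo

theorem cubes_subset_Icc {n : ℕ} {c : ℝ} (hc : 0 < c) (hc1 : c ≤ 1)
    (A : ZeroOneMatrix (fun _ : Fin d => n)) :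
    cubes c A ⊆ Set.Icc (fun _ => 0) (fun _ => (n : ℝ)) := by
  intro x hx
  obtain ⟨a, -, ha⟩ := mem_cubes.1 hx
  refine ⟨fun i => ?_, fun i => ?_⟩
  · exact le_trans (by positivity) (ha i).1.le
  · have h : ((a i : ℕ) : ℝ) + 1 ≤ n := by exact_mod_cast (a i).2
    have h0 : (0 : ℝ) ≤ ((a i : ℕ) : ℝ) + 1 := by positivity
    have := (ha i).2
    show x i ≤ n
    nlinarith

theorem lt_succ_of_scaled_lt {c x y : ℝ} (hc : 0 < c) {a b : ℕ} (hx : c * a < x)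
    (hy : y < c * (b + 1)) (hxy : x ≤ y) : a < b + 1 := by
  have h : c * a < c * (b + 1) := by linarith
  exact_mod_cast lt_of_mul_lt_mul_left h hc.le

theorem index_unique {c x : ℝ} (hc : 0 < c) {a b : ℕ}
    (ha : x ∈ Set.Ioo (c * a) (c * (a + 1))) (hb : x ∈ Set.Ioo (c * b) (c * (b + 1))) :
    a = b := by
  have h1 := lt_succ_of_scaled_lt hc ha.1 hb.2 le_rfl
  have h2 := lt_succ_of_scaled_lt hc hb.1 ha.2 le_rfl
  omega

theorem volume_cubes {n : ℕ} {c : ℝ} (hc : 0 < c) (A : ZeroOneMatrix (fun _ : Fin d => n)) :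
    volume (cubes c A) = ENNReal.ofReal c ^ d * (A.ones : ℝ≥0∞) := by
  unfold cubes
  rw [measure_biUnion_finset]
  · have h : ∀ a : Fin d → Fin n, volume (Set.univ.pi fun i =>
        Set.Ioo (c * ((a i : ℕ) : ℝ)) (c * (((a i : ℕ) : ℝ) + 1))) = ENNReal.ofReal c ^ d := by
      intro a
      rw [Real.volume_pi_Ioo]
      simp [mul_add]
    simp only [h, Finset.sum_const, nsmul_eq_mul, ones]
    rw [mul_comm]
  · intro a _ b _ hab
    refine Set.disjoint_left.2 fun x hxa hxb => hab ?_
    funext i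
    exact Fin.ext (index_unique hc (hxa i trivial) (hxb i trivial))
  · exact fun _ _ => MeasurableSet.univ_pi fun _ => measurableSet_Ioo

end ZeroOneMatrix

namespace PointSet

open ZeroOneMatrix

variable {d : ℕ}

/-! ### Gaps between coordinates of a point set -/

theorem mem_coordFinset {P : Finset (Fin d → ℝ)} {i : Fin d} {x : ℝ} :
    x ∈ coordFinset P i ↔ x ∈ coords (P : Set (Fin d → ℝ)) i := by
  simp [coordFinset, coords]

/-- The successor `z` of `x` among the coordinates satisfies `z ≤ y`, so the gap from `x` to `z`
suffices. -/
theorem le_sub_of_consecutive {P : Finset (Fin d → ℝ)} {i : Fin d} {c : ℝ}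
    (h : ∀ x y, Consecutive (P : Set (Fin d → ℝ)) i x y → c ≤ y - x) {x y : ℝ}
    (hx : x ∈ coordFinset P i) (hy : y ∈ coordFinset P i) (hxy : x < y) : c ≤ y - x := by
  obtain ⟨z, hz, hmin⟩ := ((coordFinset P i).filter (x < ·)).exists_min_image id
    ⟨y, by simp [hy, hxy]⟩
  rw [Finset.mem_filter] at hz
  have h1 := h x z ⟨mem_coordFinset.1 hx, mem_coordFinset.1 hz.1, hz.2, fun w hw hw' =>
    (hmin w (by simp [mem_coordFinset.2 hw, hw'.1])).not_gt hw'.2⟩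
  have h2 : z ≤ y := hmin y (by simp [hy, hxy])
  linarith

theorem consecutive_orderEmbOfFin {P : Finset (Fin d → ℝ)} {i : Fin d}
    {j j' : Fin (coordFinset P i).card} (h : (j' : ℕ) = j + 1) :
    Consecutive (P : Set (Fin d → ℝ)) i ((coordFinset P i).orderEmbOfFin rfl j)
      ((coordFinset P i).orderEmbOfFin rfl j') := by
  refine ⟨mem_coordFinset.1 (Finset.orderEmbOfFin_mem ..),
    mem_coordFinset.1 (Finset.orderEmbOfFin_mem ..), ?_, ?_⟩
  · rw [OrderEmbedding.lt_iff_lt, Fin.lt_def]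
    omega
  · rintro z hz ⟨h1, h2⟩
    obtain ⟨m, rfl⟩ : z ∈ Set.range ((coordFinset P i).orderEmbOfFin rfl) := by
      rw [Finset.range_orderEmbOfFin]
      exact mem_coordFinset.2 hz
    rw [OrderEmbedding.lt_iff_lt, Fin.lt_def] at h1 h2
    omega

theorem sub_le_of_consecutive {P : Finset (Fin d → ℝ)} {i : Fin d} {c : ℝ}
    (h : ∀ x y, Consecutive (P : Set (Fin d → ℝ)) i x y → y - x ≤ c)
    (m : ℕ) {j j' : Fin (coordFinset P i).card} (hm : (j' : ℕ) = j + m) :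
    (coordFinset P i).orderEmbOfFin rfl j' - (coordFinset P i).orderEmbOfFin rfl j ≤ c * m := by
  induction m generalizing j' with
  | zero =>
    obtain rfl : j' = j := Fin.ext hm
    simp
  | succ m ih =>
    have hlt : (j : ℕ) + m < (coordFinset P i).card := by
      have := j'.2
      omega
    have h1 := ih (j' := ⟨j + m, hlt⟩) rfl
    have h2 := h _ _ (consecutive_orderEmbOfFin (j := ⟨j + m, hlt⟩) (j' := j')
      (by simp [hm, add_assoc]))
    push_cast
    linarith

/-! ### Copies in cubes and copies in lattice samples -/

/-- If the coordinates of `P` are at least `c` apart, the union of cubes of an `M_P`-free matrix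
is `P`-free. -/
theorem contains_of_cubes_contains {P : Finset (Fin d → ℝ)} {c : ℝ} (hc : 0 < c)
    (h : ∀ i x y, Consecutive (P : Set (Fin d → ℝ)) i x y → c ≤ y - x) {n : ℕ}
    {A : ZeroOneMatrix (fun _ : Fin d => n)}
    (hS : Contains (cubes c A) (P : Set (Fin d → ℝ))) : A.Contains (toMatrix P) := by
  obtain ⟨f, hmaps, hexp, hmem⟩ := hS
  -- Since `f i` maps into the coordinates of the cubes, the cell index depends on the coordinate
  -- alone, not on a point of `P`.
  have hidx : ∀ i, ∀ j : Fin (coordFinset P i).card, ∃ a : Fin n,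
      f i ((coordFinset P i).orderEmbOfFin rfl j) ∈
        Set.Ioo (c * ((a : ℕ) : ℝ)) (c * (((a : ℕ) : ℝ) + 1)) := by
    intro i j
    obtain ⟨x, hx, hxi⟩ := hmaps i (mem_coordFinset.1 (Finset.orderEmbOfFin_mem _ rfl j))
    obtain ⟨a, -, ha⟩ := mem_cubes.1 hx
    exact ⟨a i, hxi ▸ ha i⟩
  choose g hg using hidx
  have hmono : ∀ i, StrictMono (g i) := by
    intro i j j' hjj'
    have hlt := (OrderEmbedding.lt_iff_lt ((coordFinset P i).orderEmbOfFin rfl)).2 hjj'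
    have hj := Finset.orderEmbOfFin_mem (coordFinset P i) rfl j
    have hj' := Finset.orderEmbOfFin_mem (coordFinset P i) rfl j'
    have h1 := le_sub_of_consecutive (h i) hj hj' hlt
    have h2 := hexp i _ (mem_coordFinset.1 hj') _ (mem_coordFinset.1 hj) hlt
    rw [ge_iff_le, le_div_iff₀ (by linarith), one_mul] at h2
    -- A shift by at least `c`, the side of a cell, leaves the cell of `j`.
    have h3 : c * ((g i j : ℕ) + 1 : ℕ) <
        f i ((coordFinset P i).orderEmbOfFin rfl j) + c := by
      push_cast
      linarith [(hg i j).1]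
    have h4 := lt_succ_of_scaled_lt hc h3 (hg i j').2 (by linarith)
    rw [Fin.lt_def]
    omega
  refine ⟨fun i => OrderEmbedding.ofStrictMono (g i) (hmono i), fun b hb => ?_⟩
  have hbP := of_decide_eq_true hb
  obtain ⟨a, ha, ha'⟩ := mem_cubes.1 (hmem _ hbP)
  convert ha using 2 with i
  funext i
  exact Fin.ext (index_unique hc (hg i (b i)) (ha' i))

open Classical in
/-- The matrix of the points of the lattice `v + L ℤ^d` that lie in `S`. -/
noncomputable def latticeMatrix (n : ℕ) (L : ℝ) (S : Set (Fin d → ℝ)) (v : Fin d → ℝ) :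
    ZeroOneMatrix (fun _ : Fin d => n) :=
  fun a => decide ((v + fun i => L * ((a i : ℕ) : ℝ)) ∈ S)

theorem exists_extension_orderEmbOfFin (s : Finset ℝ) (g : Fin s.card → ℝ) :
    ∃ f : ℝ → ℝ, ∀ j, f (s.orderEmbOfFin rfl j) = g j :=
  ⟨Function.extend (s.orderEmbOfFin rfl) g 0,
    fun j => (s.orderEmbOfFin rfl).injective.extend_apply g 0 j⟩

theorem contains_of_latticeMatrix_contains {P : Finset (Fin d → ℝ)} {L : ℝ} (hL : 0 ≤ L)
    (h : ∀ i x y, Consecutive (P : Set (Fin d → ℝ)) i x y → y - x ≤ L) {n : ℕ}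
    {S : Set (Fin d → ℝ)} {v : Fin d → ℝ}
    (hA : (latticeMatrix n L S v).Contains (toMatrix P)) :
    Contains S (P : Set (Fin d → ℝ)) := by
  obtain ⟨g, hg⟩ := hA
  choose f hf using fun i => exists_extension_orderEmbOfFin (coordFinset P i)
    fun j => v i + L * ((g i j : ℕ) : ℝ)
  have hrange : ∀ i, ∀ x ∈ coords (P : Set (Fin d → ℝ)) i,
      ∃ j, (coordFinset P i).orderEmbOfFin rfl j = x := by
    intro i x hx
    rw [← mem_coordFinset] at hx
    rwa [← Finset.mem_coe, ← Finset.range_orderEmbOfFin (coordFinset P i) rfl] at hx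
  have hmem : ∀ p ∈ P, (fun i => f i (p i)) ∈ S := by
    intro p hp
    choose b hb using fun i => hrange i (p i) ⟨p, hp, rfl⟩
    have hbP : toMatrix P b = true := by
      simp only [toMatrix, hb, decide_eq_true_eq]
      exact hp
    have hS : (v + fun i => L * (((g i (b i)) : ℕ) : ℝ)) ∈ S := by
      simpa [latticeMatrix] using hg b hbP
    convert hS using 1
    funext i
    rw [← hb i, hf]
    rfl
  refine ⟨f, ?_, ?_, hmem⟩
  · rintro i _ ⟨p, hp, rfl⟩
    exact ⟨_, hmem p hp, rfl⟩
  · intro i x hx x' hx' hlt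
    obtain ⟨j, rfl⟩ := hrange i x hx
    obtain ⟨j', rfl⟩ := hrange i x' hx'
    rw [ge_iff_le, le_div_iff₀ (by linarith), one_mul, hf, hf]
    have hjj : j' < j := (OrderEmbedding.lt_iff_lt _).1 hlt
    -- Increasing integer indices gain at least 1 per step, so `m` steps move the image by at least
    -- `L * m`, while the coordinates of `P` differ by at most `L * m`.
    have hstep : ∀ m : ℕ, ∀ k : Fin (coordFinset P i).card, (k : ℕ) = j' + m →
        (g i j' : ℕ) + m ≤ (g i k : ℕ) := by
      intro m
      induction m with
      | zero =>
        intro k hk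
        obtain rfl : k = j' := Fin.ext hk
        simp
      | succ m ih =>
        intro k hk
        have hlt : (j' : ℕ) + m < k := by omega
        have h1 := ih ⟨j' + m, hlt.trans k.2⟩ rfl
        have h2 : (g i ⟨j' + m, hlt.trans k.2⟩ : ℕ) < g i k := (g i).strictMono hlt
        omega
    have hm : (j : ℕ) = j' + (j - j' : ℕ) := by
      rw [Fin.lt_def] at hjj
      omega
    have h1 := sub_le_of_consecutive (h i) _ hm
    have h2 : ((g i j' : ℕ) : ℝ) + ((j - j' : ℕ) : ℝ) ≤ (g i j : ℕ) := by
      exact_mod_cast hstep _ j hm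
    have h3 := mul_le_mul_of_nonneg_left h2 hL
    linarith

/-! ### Averaging and the two bounds -/

/-- Averaging over the translates of a lattice bounds the measure of a set by the largest number
of lattice points in it. -/
theorem volume_le_of_latticeMatrix_ones_le {n : ℕ} (hn : 1 ≤ n) {L : ℝ} (hL : 1 < L)
    {S : Set (Fin d → ℝ)} (hS : MeasurableSet S)
    (hsub : S ⊆ Set.Icc (fun _ => 0) (fun _ => (n : ℝ))) {N : ℕ}
    (hN : ∀ v, (latticeMatrix n L S v).ones ≤ N) :
    volume S ≤ ENNReal.ofReal L ^ d * (N : ℝ≥0∞) := by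
  have hL0 : 0 < L := by linarith
  let t : (Fin d → Fin n) → Fin d → ℝ := fun a i => L * ((a i : ℕ) : ℝ)
  let Q : Set (Fin d → ℝ) := Set.univ.pi fun _ => Set.Ico 0 L
  have hQ : volume Q = ENNReal.ofReal L ^ d := by
    simp only [Q]
    rw [Real.volume_pi_Ico]
    simp
  have hQm : MeasurableSet Q := MeasurableSet.univ_pi fun _ => measurableSet_Ico
  -- The piece of `S` in each cell `t a + Q` is translated back to the fundamental domain `Q`.
  have hcover : S ⊆ ⋃ a, (· + -t a) ⁻¹' (((· + t a) ⁻¹' S) ∩ Q) := by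
    intro x hx
    have hx0 : ∀ i, 0 ≤ x i / L := fun i => div_nonneg ((hsub hx).1 i) hL0.le
    -- `1 < L` is needed for the strict inequality, as `x i = n` may occur.
    have hfl : ∀ i, ⌊x i / L⌋₊ < n := by
      intro i
      rw [Nat.floor_lt (hx0 i), div_lt_iff₀ hL0]
      have h1 : x i ≤ n := (hsub hx).2 i
      have h2 : (1 : ℝ) ≤ n := by exact_mod_cast hn
      nlinarith
    refine Set.mem_iUnion.2 ⟨fun i => ⟨⌊x i / L⌋₊, hfl i⟩, ?_, fun i _ => ?_⟩
    · simpa using hx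
    · have h1 := Nat.floor_le (hx0 i)
      have h2 := Nat.lt_floor_add_one (x i / L)
      rw [le_div_iff₀ hL0] at h1
      rw [div_lt_iff₀ hL0] at h2
      constructor <;> simp only [t, Pi.add_apply, Pi.neg_apply] <;> linarith
  have hmeas : ∀ a, MeasurableSet ((· + t a) ⁻¹' S) :=
    fun a => hS.preimage (measurable_add_const (t a))
  calc volume S ≤ ∑ a, volume ((· + -t a) ⁻¹' (((· + t a) ⁻¹' S) ∩ Q)) :=
        (measure_mono hcover).trans (measure_iUnion_fintype_le _ _)
    _ = ∑ a, ∫⁻ v in Q, ((· + t a) ⁻¹' S).indicator 1 v := by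
        refine Finset.sum_congr rfl fun a _ => ?_
        rw [measure_preimage_add_right, lintegral_indicator_one (hmeas a),
          Measure.restrict_apply (hmeas a)]
    _ = ∫⁻ v in Q, ∑ a, ((· + t a) ⁻¹' S).indicator 1 v :=
        (lintegral_finsetSum _ fun a _ => measurable_one.indicator (hmeas a)).symm
    _ ≤ ∫⁻ _ in Q, (N : ℝ≥0∞) := by
        -- For fixed `v` the sum counts the points of the translated lattice in `S`.
        refine lintegral_mono fun v => ?_
        refine le_trans (le_of_eq ?_) (Nat.cast_le.2 (hN v))
        classical
        simp [ones, latticeMatrix, Set.indicator_apply, t]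
    _ = ENNReal.ofReal L ^ d * (N : ℝ≥0∞) := by
        rw [setLIntegral_const, hQ, mul_comm]

/-- The lower bound for `px`. -/
theorem ex_le_px {P : Finset (Fin d → ℝ)} {c : ℝ} (hc : 0 < c) (hc1 : c ≤ 1)
    (h : ∀ i x y, Consecutive (P : Set (Fin d → ℝ)) i x y → c ≤ y - x) (n : ℕ) :
    ENNReal.ofReal c ^ d * (ex n (toMatrix P) : ℝ≥0∞) ≤ px (n : ℝ) (P : Set (Fin d → ℝ)) := by
  rcases ex_eq_zero_or_exists n (toMatrix P) with h0 | ⟨A, hA, hA'⟩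
  · simp [h0]
  · rw [← hA', ← volume_cubes hc]
    exact le_iSup₂_of_le (cubes c A) ⟨isOpen_cubes c A, cubes_subset_Icc hc hc1 A,
      fun hS => hA (contains_of_cubes_contains hc h hS)⟩ le_rfl

/-- The upper bound for `px`. -/
theorem px_le_ex {P : Finset (Fin d → ℝ)} {L : ℝ} (hL : 1 < L)
    (h : ∀ i x y, Consecutive (P : Set (Fin d → ℝ)) i x y → y - x ≤ L) {n : ℕ} (hn : 1 ≤ n) :
    px (n : ℝ) (P : Set (Fin d → ℝ)) ≤ ENNReal.ofReal L ^ d * (ex n (toMatrix P) : ℝ≥0∞) :=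
  iSup₂_le fun _ hS => volume_le_of_latticeMatrix_ones_le hn hL hS.1.measurableSet hS.2.1
    fun _ => ones_le_ex fun hA =>
      hS.2.2 (contains_of_latticeMatrix_contains (by linarith) h hA)

end PointSet

theorem mainTheorem6 (d : ℕ) (c₁ c₂ : ℝ) (hc₁ : 0 < c₁) (hc : c₁ ≤ c₂) :
    ∃ A B : ℝ≥0, 0 < A ∧ 0 < B ∧
      ∀ P : Finset (Fin d → ℝ),
        (∀ i x y, PointSet.Consecutive (P : Set (Fin d → ℝ)) i x y →
          c₁ ≤ y - x ∧ y - x ≤ c₂) →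
        ∀ n : ℕ, 1 ≤ n →
          (A : ℝ≥0∞) * ((ZeroOneMatrix.ex n (PointSet.toMatrix P) : ℕ) : ℝ≥0∞)
              ≤ PointSet.px (n : ℝ) (P : Set (Fin d → ℝ)) ∧
          PointSet.px (n : ℝ) (P : Set (Fin d → ℝ))
              ≤ (B : ℝ≥0∞) * ((ZeroOneMatrix.ex n (PointSet.toMatrix P) : ℕ) : ℝ≥0∞) := by
  -- The bound 1 keeps the cubes inside `[0, n]^d`; the 2 below only ensures `1 < L`.
  have hc0 : 0 < min c₁ 1 := lt_min hc₁ one_pos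
  have hL : 1 < max c₂ 2 := lt_of_lt_of_le one_lt_two (le_max_right _ _)
  refine ⟨(min c₁ 1).toNNReal ^ d, (max c₂ 2).toNNReal ^ d, ?_, ?_, fun P hP n hn => ⟨?_, ?_⟩⟩
  · exact pow_pos (Real.toNNReal_pos.2 hc0) d
  · exact pow_pos (Real.toNNReal_pos.2 (by linarith)) d
  · rw [ENNReal.coe_pow]
    exact PointSet.ex_le_px hc0 (min_le_right _ _)
      (fun i x y hxy => (min_le_left _ _).trans (hP i x y hxy).1) n
  · rw [ENNReal.coe_pow]
    exact PointSet.px_le_ex hL (fun i x y hxy => (hP i x y hxy).2.trans (le_max_left _ _)) hn
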